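/- All groups are finite. A group is semisimple if it has no nontrivial abelian normal subgroup; $\mathrm{Soc}(G)$ is the subgroup generated by the minimal normal subgroups of $G$, and $\mathrm{Fac}(\mathrm{Soc}(G))$ is the set of its simple direct factors. For $G$ semisimple, $\mathrm{Soc}(G)$ is the internal direct product of the members $S_1,\dots,S_m$ of $\mathrm{Fac}(\mathrm{Soc}(G))$, and the weight $\mathrm{wt}(s)$ of $s=s_1\cdots s_m$ ($s_i\in S_i$) is the number of $i$ with $s_i\neq 1$. The 2-ary bijective pebble game (Version II) on $G$ and $H$ with $k$ pairs of pebbles: in each round Spoiler picks up two pairs of pebbles (or one pair), Duplicator chooses a bijection $f\colon G\to H$, and Spoiler places each of these pairs on some $v\in G$ and on $f(v)\in H$. The winning condition is checked each time Spoiler has picked up pebbles (also after the last round): Spoiler wins if the pairs $(g_1,h_1),\dots,(g_l,h_l)$ then pebbled do not give a marked isomorphism, i.e. if $g_i\mapsto h_i$ is not a well-defined injective map that extends to an isomorphism $\langle g_1,\dots,g_l\rangle\to\langle h_1,\dots,h_l\rangle$. **Proposition.** Let $G$ and $H$ be semisimple groups with isomorphic socles. Let $\mathrm{Fac}(\mathrm{Soc}(G))=\{S_1,\dots,S_m\}$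 (without repetition) with $S_i=\langle x_i,y_i\rangle$. Consider the game with $7$ pairs of pebbles. Let $f_0\colon G\to H$ be a bijection selected by Duplicator in the first round such that (i) for all $i$, $f_0(S_i)\in\mathrm{Fac}(\mathrm{Soc}(H))$ and $f_0(S_i)\cong S_i$ (though $f_0|_{S_i}$ need not be an isomorphism); (ii) for all $s\in\mathrm{Soc}(G)$, $f_0(s)\in\mathrm{Soc}(H)$ and $\mathrm{wt}(f_0(s))=\mathrm{wt}(s)$; (iii) for all $i$, $f_0(S_i)=\langle f_0(x_i),f_0(y_i)\rangle$. Suppose that Spoiler then places two pairs of pebbles on $x:=x_1\cdots x_m\mapsto f_0(x)$ and $y:=y_1\cdots y_m\mapsto f_0(y)$. Consider any subsequent round such that these two pairs have not been moved and Spoiler picks up two other pairs, and let $f'\colon G\to H$ be the bijection that Duplicator selects in it. Then either $f'$ restricts to an isomorphism $\mathrm{Soc}(G)\to\mathrm{Soc}(H)$, or Spoiler can win in at most $4$ rounds counted from this one (inclusive). Thus $7$ pairs of pebbles suffice in total, and $5$ rounds in total if the round of $f'$ is the second. -/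

import Mathlib

namespace PebbleGame

section Groups

variable (G : Type*) [Group G]

/-- A group is semisimple if it has no nontrivial abelian normal subgroup. -/
def IsSemisimple : Prop :=
  ∀ N : Subgroup G, N.Normal → (∀ a ∈ N, ∀ b ∈ N, a * b = b * a) → N = ⊥

variable {G}

/-- `N` is minimal among the nontrivial normal subgroups of `G`. -/
def IsMinimalNormal (N : Subgroup G) : Prop :=
  N.Normal ∧ N ≠ ⊥ ∧ ∀ M : Subgroup G, M.Normal → M ≤ N → M = ⊥ ∨ M = N

variable (G)

/-- The socle: the subgroup generated by all minimal normal subgroups. -/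
def socle : Subgroup G :=
  sSup {N : Subgroup G | IsMinimalNormal N}

/-- `Fac(Soc(G))`: the subgroups `S` of `Soc(G)` that are simple groups and internal direct
factors of `Soc(G)`, that is, `Soc(G) = S × C` for some subgroup `C`. -/
def socleFactors : Set (Subgroup G) :=
  {S | IsSimpleGroup S ∧ ∃ C : Subgroup G,
    S ⊔ C = socle G ∧ S ⊓ C = ⊥ ∧ ∀ s ∈ S, ∀ c ∈ C, s * c = c * s}

variable {G}

/-- `HasWeight s w`: for an enumeration `T₁, …, Tₙ` without repetition of the simple direct
factors of the socle, `s = c₁ ⋯ cₙ` with `cᵢ ∈ Tᵢ`, and exactly `w` of the `cᵢ` are not `1`.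
(In a finite semisimple group `w` is determined by `s`, and exists iff `s` is in the socle.) -/
def HasWeight (s : G) (w : ℕ) : Prop :=
  ∃ (n : ℕ) (T : Fin n → Subgroup G) (c : Fin n → G),
    Function.Injective T ∧ Set.range T = socleFactors G ∧
    (∀ i, c i ∈ T i) ∧ s = (List.ofFn c).prod ∧ {i | c i ≠ 1}.ncard = w

end Groups

section Game

/-- A board of the game with `k` pairs of pebbles on the groups `G`, `H`: the `i`-th pair is either
beside the groups (`none`), or placed on an element of `G` and an element of `H`. -/
abbrev Board (k : ℕ) (G H : Type*) := Fin k → Option (G × H)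

variable {k : ℕ} {G H : Type*}

/-- The pairs of pebbles `i` and `j` are picked up (one pair only, if `i = j`). -/
def Board.pickUp (p : Board k G H) (i j : Fin k) : Board k G H :=
  Function.update (Function.update p i none) j none

/-- The pairs of pebbles `i` and `j` are placed on `v ↦ f v` and `w ↦ f w`
(the only pair, if `i = j`, on `w ↦ f w`). -/
def Board.place (p : Board k G H) (i j : Fin k) (f : G ≃ H) (v w : G) : Board k G H :=
  Function.update (Function.update p i (some (v, f v))) j (some (w, f w))

/-- The elements of `G` that carry a pebble. -/
def Board.left (p : Board k G H) : Set G := {g | ∃ i h, p i = some (g, h)}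

/-- The elements of `H` that carry a pebble. -/
def Board.right (p : Board k G H) : Set H := {h | ∃ i g, p i = some (g, h)}

variable [Group G] [Group H]

/-- The pebbled tuples give a marked isomorphism: the pebbles give a well-defined map, and it
extends to an isomorphism between the subgroups that the pebbled elements generate. -/
def Board.MarkedIso (p : Board k G H) : Prop :=
  (∀ i j g g' h h', p i = some (g, h) → p j = some (g', h') → (g = g' ↔ h = h')) ∧
  ∃ φ : Subgroup.closure p.left ≃* Subgroup.closure p.right,
    ∀ (i : Fin k) (h : H) (z : Subgroup.closure p.left), p i = some ((z : G), h) → (φ z : H) = h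

/-- Spoiler has a winning strategy from the board `p`, with `r` more rounds to be played, in the
2-ary bijective pebble game (Version II) on `G` and `H` with `k` pairs of pebbles.

A round: Spoiler picks up two pairs of pebbles, or one; the winning condition is checked (Spoiler
has won if the remaining pebbles do not give a marked isomorphism); Duplicator chooses a bijection
`f : G ≃ H`; Spoiler places each of the pairs picked up on some `v ↦ f v`.
As the condition is checked at pick-up, the pebbles placed in the last of the `r` rounds are
checked when Spoiler has once more picked up pebbles. This is the more demanding convention for
Spoiler: to win here implies to win when all the pebbles are checked at the end of each round. -/
def SpoilerWins : ℕ → Board k G H → Prop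
  | 0, p => ∃ i j : Fin k, ¬ (p.pickUp i j).MarkedIso
  | r + 1, p => ∃ i j : Fin k, ¬ (p.pickUp i j).MarkedIso ∨
      ∀ f : G ≃ H, ∃ v w : G, SpoilerWins r (p.place i j f v w)

/-- The position within a round in which Spoiler has picked up the pairs `i` and `j` from the board
`p` and Duplicator has answered with the bijection `f`: Spoiler can win in `r + 1` rounds, the
present one included. -/
def SpoilerWinsAgainst (r : ℕ) (p : Board k G H) (i j : Fin k) (f : G ≃ H) : Prop :=
  ∃ v w : G, SpoilerWins r (p.place i j f v w)

/-- The bijection `f` restricts to an isomorphism `Soc(G) → Soc(H)`. -/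
def RestrictsToSocleIso (f : G ≃ H) : Prop :=
  ∃ φ : socle G ≃* socle H, ∀ s : socle G, (φ s : H) = f s

end Game

end PebbleGame

/-!
Suppose that Spoiler does not win against `f`, the bijection `f'` of the statement. Write
`A = Soc(G)`, and `X`, `Y` for the two elements pebbled in the first round, `D = ⟨X, Y⟩`.

Whatever two elements `v`, `w` Spoiler places his pebbles on, the elements `X, Y, v, w` and their
images are marked isomorphic. Hence `f` respects commutation, `f 1 = 1`, and
`f (d v) = f d · f v`, `f (v d) = f v · f d` for all `d ∈ D` and all `v`
(`apply_mul_of_mem_closure`).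

The three rounds after the present one are used to see that `f` maps `A` onto `Soc(H)`. An element
`c` is `1` or in a minimal normal subgroup if and only if it lies in the normal closure of each
nontrivial element `d` of its own normal closure. If `c` has this property and the element
corresponding to it has not, Spoiler pebbles a witness `d`, and then some normal closure is not
respected. The normal closure of `d` is the component of `1` in the Cayley graph of the conjugacy
class of `d`, so one round with two pairs of pebbles exhibits an edge that is not respected, however
long the path to it is, and one more round shows the conjugating element
(`ForcedWin.of_generatesMinimalNormal`). Applied to `c = v⁻¹ w` for all `v`, `w`, this says that
`f` maps the edges of the Cayley graph of the union of the minimal normal subgroups to pairs in the same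
coset of `Soc(H)`, whence `f(A) ⊆ Soc(H)`, and equality holds as the socles have the same order
(`mem_socle_iff_apply_mem_socle`).

Let now `Kᵢ = C_A(Sᵢ)`. As `f` respects commutation and the socles, `f(Kᵢ) = C_{Soc(H)}(f(Sᵢ))`,
which is a subgroup; it is normalized by `f(D)`. Since `A` is the direct product of the `Sᵢ` and
`Sᵢ = ⟨xᵢ, yᵢ⟩`, the group `D` projects onto every factor: `A = D Kᵢ`. For `s ∈ d Kᵢ` and `t ∈ e Kᵢ`
both `f (s t)` and `f s · f t` therefore lie in `f(d) f(e) f(Kᵢ)` (`apply_mul_modulo`). The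
intersection of the `Kᵢ` is the centre of `A`, which is trivial because `G` is semisimple, so
`f (s t) = f s · f t` (`map_mul_of_commute_iff`).

That the simple direct factors generate the socle is `socle_le_sSup_socleFactors`; they are the
minimal normal subgroups of the socle.
-/

namespace PebbleGame

/-! ### Simple factors of the socle -/

section Socle

variable {G : Type*} [Group G]

lemma le_normalizer_of_forall {A R : Subgroup G} (h : ∀ a ∈ A, ∀ r ∈ R, a * r * a⁻¹ ∈ R) :
    A ≤ Subgroup.normalizer (R : Set G) := by
  intro a ha
  rw [Subgroup.mem_normalizer_iff]
  intro r
  refine ⟨h a ha r, fun hr => ?_⟩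
  have := h a⁻¹ (inv_mem ha) _ hr
  simpa [mul_assoc] using this

lemma conj_mem_of_le_normalizer {A R : Subgroup G} (h : A ≤ Subgroup.normalizer (R : Set G))
    {a r : G} (ha : a ∈ A) (hr : r ∈ R) : a * r * a⁻¹ ∈ R :=
  (Subgroup.mem_normalizer_iff.1 (h ha) r).1 hr

lemma commute_of_inf_eq_bot {A R T : Subgroup G} (hRA : R ≤ A) (hTA : T ≤ A)
    (hR : A ≤ Subgroup.normalizer (R : Set G)) (hT : A ≤ Subgroup.normalizer (T : Set G))
    (h : R ⊓ T = ⊥) {r t : G} (hr : r ∈ R) (ht : t ∈ T) : r * t = t * r := by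
  have h1 : r * t * r⁻¹ * t⁻¹ ∈ R ⊓ T := by
    refine ⟨?_, T.mul_mem (conj_mem_of_le_normalizer hT (hRA hr) ht) (T.inv_mem ht)⟩
    have := R.mul_mem hr (conj_mem_of_le_normalizer hR (hTA ht) (R.inv_mem hr))
    simpa [mul_assoc] using this
  rw [h, Subgroup.mem_bot] at h1
  have h2 := mul_inv_eq_one.1 h1
  exact mul_inv_eq_iff_eq_mul.1 h2

lemma normal_sSup_of_conj_mem {F : Set (Subgroup G)}
    (h : ∀ R ∈ F, ∀ g : G, R.map (MulAut.conj g).toMonoidHom ∈ F) : (sSup F).Normal := by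
  constructor
  intro n hn g
  have h1 : (sSup F).map (MulAut.conj g).toMonoidHom ≤ sSup F := by
    rw [Subgroup.map_le_iff_le_comap]
    refine sSup_le fun R hR => ?_
    rw [← Subgroup.map_le_iff_le_comap]
    exact le_sSup (h R hR g)
  exact h1 ⟨n, hn, rfl⟩

lemma socle_normal : (socle G).Normal := by
  apply normal_sSup_of_conj_mem
  intro N hN g
  have h : N.map (MulAut.conj g).toMonoidHom = N := by
    have := hN.1
    exact Subgroup.mem_normalizer_iff_map_conj_eq.1
      (by rw [Subgroup.normalizer_eq_top]; exact Subgroup.mem_top g)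
  rwa [h]

/-- `R` is minimal among the nontrivial subgroups of `A` that `A` normalizes, that is, it is a
minimal normal subgroup of `A`, considered as a subgroup of the ambient group. -/
def IsMinimalNormalIn (A R : Subgroup G) : Prop :=
  R ≤ A ∧ R ≠ ⊥ ∧ A ≤ Subgroup.normalizer (R : Set G) ∧
    ∀ M ≤ R, M ≠ ⊥ → A ≤ Subgroup.normalizer (M : Set G) → M = R

lemma exists_isMinimalNormalIn_le [Finite G] {A N : Subgroup G} (hNA : N ≤ A) (hN : N ≠ ⊥)
    (hA : A ≤ Subgroup.normalizer (N : Set G)) : ∃ R ≤ N, IsMinimalNormalIn A R := by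
  obtain ⟨R, hRN, hR⟩ := exists_minimal_le_of_wellFoundedLT
    (fun R : Subgroup G => R ≠ ⊥ ∧ A ≤ Subgroup.normalizer (R : Set G)) N ⟨hN, hA⟩
  exact ⟨R, hRN, hRN.trans hNA, hR.1.1, hR.1.2,
    fun M hM h1 h2 => le_antisymm hM (hR.2 ⟨h1, h2⟩ hM)⟩

lemma le_normalizer_inf {A R T : Subgroup G} (hR : A ≤ Subgroup.normalizer (R : Set G))
    (hT : A ≤ Subgroup.normalizer (T : Set G)) :
    A ≤ Subgroup.normalizer ((R ⊓ T : Subgroup G) : Set G) :=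
  le_normalizer_of_forall fun _ ha _ hr =>
    ⟨conj_mem_of_le_normalizer hR ha hr.1, conj_mem_of_le_normalizer hT ha hr.2⟩

lemma IsMinimalNormalIn.commute {A R T : Subgroup G} (hR : IsMinimalNormalIn A R)
    (hT : IsMinimalNormalIn A T) (hne : R ≠ T) {r t : G} (hr : r ∈ R) (ht : t ∈ T) :
    r * t = t * r := by
  refine commute_of_inf_eq_bot hR.1 hT.1 hR.2.2.1 hT.2.2.1 ?_ hr ht
  by_contra h
  have h1 := le_normalizer_inf hR.2.2.1 hT.2.2.1
  exact hne ((hR.2.2.2 _ inf_le_left h h1).symm.trans (hT.2.2.2 _ inf_le_right h h1))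

lemma IsMinimalNormalIn.map_conj {A R : Subgroup G} [hA : A.Normal] (hR : IsMinimalNormalIn A R)
    (g : G) : IsMinimalNormalIn A (R.map (MulAut.conj g).toMonoidHom) := by
  have key : ∀ (M : Subgroup G) (k : G), A ≤ Subgroup.normalizer (M : Set G) →
      A ≤ Subgroup.normalizer ((M.map (MulAut.conj k).toMonoidHom : Subgroup G) : Set G) := by
    intro M k hM
    refine le_normalizer_of_forall ?_
    rintro a ha _ ⟨r, hr, rfl⟩
    have h1 : k⁻¹ * a * k ∈ A := by simpa using hA.conj_mem a ha k⁻¹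
    refine ⟨_, conj_mem_of_le_normalizer hM h1 hr, ?_⟩
    simp [mul_assoc]
  have back : ∀ (M : Subgroup G) (k : G),
      (M.map (MulAut.conj k).toMonoidHom).map (MulAut.conj k⁻¹).toMonoidHom = M := by
    intro M k
    rw [Subgroup.map_map]
    convert M.map_id
    ext z
    simp [mul_assoc]
  refine ⟨?_, ?_, key R g hR.2.2.1, ?_⟩
  · rintro _ ⟨r, hr, rfl⟩
    exact hA.conj_mem r (hR.1 hr) g
  · intro h
    apply hR.2.1
    rw [← back R g, h, Subgroup.map_bot]
  · intro M hM hne hAM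
    have h1 : M.map (MulAut.conj g⁻¹).toMonoidHom = R := by
      apply hR.2.2.2 _ _ _ (key M g⁻¹ hAM)
      · rw [← back R g]
        exact Subgroup.map_mono hM
      · intro h
        apply hne
        rw [← back M g⁻¹, h, Subgroup.map_bot]
    rw [← h1]
    simpa using (back M g⁻¹).symm

/-- The subgroup generated by the minimal normal subgroups of the socle is normal in the whole group and meets
every minimal normal subgroup of the group, hence contains it. -/
lemma socle_eq_sSup_isMinimalNormalIn [Finite G] :
    socle G = sSup {R | IsMinimalNormalIn (socle G) R} := by
  have hA : (socle G).Normal := socle_normal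
  apply le_antisymm
  · have hQ : (sSup {R | IsMinimalNormalIn (socle G) R}).Normal :=
      normal_sSup_of_conj_mem fun R hR g => IsMinimalNormalIn.map_conj hR g
    refine sSup_le fun N hN => ?_
    have := hN.1
    obtain ⟨R, hRN, hR⟩ := exists_isMinimalNormalIn_le (A := socle G) (le_sSup hN) hN.2.1
      (by rw [Subgroup.normalizer_eq_top]; exact le_top)
    have h1 : R ≤ N ⊓ sSup {R | IsMinimalNormalIn (socle G) R} := le_inf hRN (le_sSup hR)
    rcases hN.2.2 (N ⊓ sSup {R | IsMinimalNormalIn (socle G) R}) inferInstance inf_le_left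
      with h | h
    · exact absurd (le_bot_iff.1 (h ▸ h1)) hR.2.1
    · exact inf_eq_left.1 h
  · exact sSup_le fun R hR => hR.1

lemma IsSemisimple.eq_one_of_commute_socle (hG : IsSemisimple G) {a : G} (ha : a ∈ socle G)
    (h : ∀ b ∈ socle G, a * b = b * a) : a = 1 := by
  have hA : (socle G).Normal := socle_normal
  have hZ := hG (socle G ⊓ Subgroup.centralizer (socle G : Set G)) inferInstance
    fun x hx y hy => (Subgroup.mem_centralizer_iff.1 hx.2 y hy.1).symm
  rw [← Subgroup.mem_bot, ← hZ]
  exact ⟨ha, Subgroup.mem_centralizer_iff.2 fun b hb => (h b hb).symm⟩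

lemma mem_centralizer_sSup {F : Set (Subgroup G)} {a : G}
    (h : ∀ R ∈ F, ∀ r ∈ R, a * r = r * a) {b : G} (hb : b ∈ sSup F) : a * b = b * a := by
  have h1 : sSup F ≤ Subgroup.centralizer {a} :=
    sSup_le fun R hR r hr => Subgroup.mem_centralizer_singleton_iff.2 (h R hR r hr).symm
  exact (Subgroup.mem_centralizer_singleton_iff.1 (h1 hb)).symm

lemma IsMinimalNormalIn.mem_socleFactors [Finite G] (hG : IsSemisimple G) {R : Subgroup G}
    (hR : IsMinimalNormalIn (socle G) R) : R ∈ socleFactors G := by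
  have hA : (socle G).Normal := socle_normal
  have hsup : R ⊔ (socle G ⊓ Subgroup.centralizer (R : Set G)) = socle G := by
    apply le_antisymm (sup_le hR.1 inf_le_left)
    conv_lhs => rw [socle_eq_sSup_isMinimalNormalIn]
    refine sSup_le fun T hT => ?_
    by_cases h : T = R
    · rw [h]; exact le_sup_left
    · refine le_sup_of_le_right fun t ht => ⟨hT.1 ht, Subgroup.mem_centralizer_iff.2 fun r hr => ?_⟩
      exact hR.commute hT (Ne.symm h) hr ht
  have hinf : R ⊓ (socle G ⊓ Subgroup.centralizer (R : Set G)) = ⊥ := by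
    rw [eq_bot_iff]
    rintro r ⟨hr, hrA, hrC⟩
    have hrR : ∀ t ∈ R, r * t = t * r := fun t ht => (Subgroup.mem_centralizer_iff.1 hrC t ht).symm
    refine hG.eq_one_of_commute_socle hrA fun b hb => ?_
    rw [← hsup] at hb
    have : R ⊔ (socle G ⊓ Subgroup.centralizer (R : Set G)) ≤ Subgroup.centralizer {r} :=
      sup_le (fun t ht => Subgroup.mem_centralizer_singleton_iff.2 (hrR t ht).symm)
        fun t ht => Subgroup.mem_centralizer_singleton_iff.2
          (Subgroup.mem_centralizer_iff.1 ht.2 r hr).symm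
    exact (Subgroup.mem_centralizer_singleton_iff.1 (this hb)).symm
  refine ⟨?_, socle G ⊓ Subgroup.centralizer (R : Set G), hsup, hinf,
    fun s hs c hc => Subgroup.mem_centralizer_iff.1 hc.2 s hs⟩
  have : Nontrivial R := (Subgroup.nontrivial_iff_ne_bot R).2 hR.2.1
  refine ⟨fun M hM => ?_⟩
  by_cases hM1 : M = ⊥
  · exact Or.inl hM1
  right
  have hMR : M.map R.subtype = R := by
    apply hR.2.2.2
    · exact Subgroup.map_subtype_le M
    · rwa [Ne, Subgroup.map_eq_bot_iff_of_injective _ R.subtype_injective]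
    · conv_lhs => rw [← hsup]
      refine sup_le (le_normalizer_of_forall ?_) (le_normalizer_of_forall ?_)
      · rintro r hr _ ⟨z, hz, rfl⟩
        exact ⟨_, hM.conj_mem z hz ⟨r, hr⟩, rfl⟩
      · rintro c hc _ ⟨z, hz, rfl⟩
        have := Subgroup.mem_centralizer_iff.1 hc.2 z z.2
        refine ⟨z, hz, ?_⟩
        change (z : G) = c * z * c⁻¹
        rw [← this, mul_inv_cancel_right]
  rw [eq_top_iff]
  intro z _
  have hz : (z : G) ∈ M.map R.subtype := by rw [hMR]; exact z.2
  obtain ⟨z', hz', h⟩ := hz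
  rwa [← Subtype.ext h]

/-- The socle of a finite semisimple group is generated by its simple direct factors. -/
lemma socle_le_sSup_socleFactors [Finite G] (hG : IsSemisimple G) :
    socle G ≤ sSup (socleFactors G) := by
  rw [socle_eq_sSup_isMinimalNormalIn]
  exact sSup_le_sSup fun R hR => IsMinimalNormalIn.mem_socleFactors hG hR

lemma le_socle_of_mem_socleFactors {S : Subgroup G} (hS : S ∈ socleFactors G) : S ≤ socle G := by
  obtain ⟨-, C, h, -⟩ := hS
  exact h ▸ le_sup_left

lemma socle_le_normalizer_of_mem_socleFactors {S : Subgroup G} (hS : S ∈ socleFactors G) :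
    socle G ≤ Subgroup.normalizer (S : Set G) := by
  obtain ⟨-, C, h, -, hC⟩ := hS
  rw [← h]
  refine sup_le Subgroup.le_normalizer (le_normalizer_of_forall fun c hc s hs => ?_)
  rwa [← hC s hs c hc, mul_inv_cancel_right]

lemma eq_of_le_of_isSimpleGroup {S M : Subgroup G} [IsSimpleGroup S] (hMS : M ≤ S) (hM : M ≠ ⊥)
    (h : S ≤ Subgroup.normalizer (M : Set G)) : M = S := by
  rcases IsSimpleGroup.eq_bot_or_eq_top_of_normal (M.subgroupOf S)
    ⟨fun z hz s => conj_mem_of_le_normalizer h s.2 hz⟩ with h1 | h1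
  · rw [Subgroup.subgroupOf_eq_bot, disjoint_iff, inf_eq_left.2 hMS] at h1
    exact absurd h1 hM
  · exact le_antisymm hMS (Subgroup.subgroupOf_eq_top.1 h1)

lemma commute_of_mem_socleFactors {S T : Subgroup G} (hS : S ∈ socleFactors G)
    (hT : T ∈ socleFactors G) (hne : S ≠ T) {s t : G} (hs : s ∈ S) (ht : t ∈ T) :
    s * t = t * s := by
  have hSn := socle_le_normalizer_of_mem_socleFactors hS
  have hTn := socle_le_normalizer_of_mem_socleFactors hT
  have hSA := le_socle_of_mem_socleFactors hS
  have hTA := le_socle_of_mem_socleFactors hT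
  refine commute_of_inf_eq_bot hSA hTA hSn hTn ?_ hs ht
  by_contra h
  have hn := le_normalizer_inf hSn hTn
  have := hS.1
  have := hT.1
  exact hne ((eq_of_le_of_isSimpleGroup inf_le_left h (hSA.trans hn)).symm.trans
    (eq_of_le_of_isSimpleGroup inf_le_right h (hTA.trans hn)))

end Socle

/-! ### Bijections that are compatible with Cayley graphs -/

section Cayley

variable {G H : Type*} [Group G] [Group H]

/-- A map that sends the edges of the Cayley graph of `X` to elements of a subgroup maps the
connected component of `1` into that subgroup. -/
lemma apply_mem_of_mem_closure {X : Set G} {B : Subgroup H} (f : G → H) (h1 : f 1 = 1)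
    (h : ∀ v w, v⁻¹ * w ∈ X → (f v)⁻¹ * f w ∈ B) {z : G} (hz : z ∈ Subgroup.closure X) :
    f z ∈ B := by
  induction hz using Subgroup.closure_induction_right with
  | one => rw [h1]; exact B.one_mem
  | mul_right v _ y hy ih =>
    have := B.mul_mem ih (h v (v * y) (by simpa using hy))
    simpa using this
  | mul_inv_cancel v _ y hy ih =>
    have := B.mul_mem ih (B.inv_mem (h (v * y⁻¹) v (by simpa [mul_assoc] using hy)))
    simpa using this

lemma apply_mem_normalClosure {a : G} {a' : H} (f : G → H) (h1 : f 1 = 1)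
    (h : ∀ v w, IsConj a (v⁻¹ * w) → IsConj a' ((f v)⁻¹ * f w)) {z : G}
    (hz : z ∈ Subgroup.normalClosure {a}) : f z ∈ Subgroup.normalClosure {a'} := by
  refine apply_mem_of_mem_closure f h1 (fun v w hvw => ?_) hz
  obtain ⟨b, rfl, hb⟩ := Group.mem_conjugatesOfSet_iff.1 hvw
  exact Subgroup.conjugatesOfSet_subset_normalClosure
    (Group.mem_conjugatesOfSet_iff.2 ⟨a', rfl, h v w hb⟩)

end Cayley

/-! ### Winning positions of Spoiler -/

section Board

variable {k : ℕ} {G H : Type*}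

lemma Board.pickUp_apply_of_ne (p : Board k G H) {i j l : Fin k} (hi : l ≠ i) (hj : l ≠ j) :
    p.pickUp i j l = p l := by
  simp [Board.pickUp, hi, hj]

lemma Board.place_apply_of_ne (p : Board k G H) {i j l : Fin k} (f : G ≃ H) (v w : G)
    (hi : l ≠ i) (hj : l ≠ j) : p.place i j f v w l = p l := by
  simp [Board.place, hi, hj]

lemma Board.place_apply_left (p : Board k G H) {i j : Fin k} (hij : i ≠ j) (f : G ≃ H) (v w : G) :
    p.place i j f v w i = some (v, f v) := by
  simp [Board.place, hij]

lemma Board.place_apply_right (p : Board k G H) (i j : Fin k) (f : G ≃ H) (v w : G) :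
    p.place i j f v w j = some (w, f w) := by
  simp [Board.place]

end Board

section Strategy

variable {k : ℕ} {G H : Type*} [Group G] [Group H]

/-- The subgroup of `G × H` generated by those pairs of the board `p` whose index is in `I`. If the
pebbles give a marked isomorphism, it is contained in the graph of that isomorphism. -/
def Board.graph (p : Board k G H) (I : Finset (Fin k)) : Subgroup (G × H) :=
  Subgroup.closure {z | ∃ i ∈ I, p i = some z}

lemma Board.mem_graph {p : Board k G H} {I : Finset (Fin k)} {i : Fin k} (hi : i ∈ I) {z : G × H}
    (h : p i = some z) : z ∈ p.graph I :=
  Subgroup.subset_closure ⟨i, hi, h⟩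

lemma Board.graph_le_graph {p q : Board k G H} {I J : Finset (Fin k)} (hIJ : I ⊆ J)
    (h : ∀ i ∈ I, q i = p i) : p.graph I ≤ q.graph J := by
  rw [Board.graph, Subgroup.closure_le]
  rintro z ⟨i, hi, hz⟩
  exact Board.mem_graph (hIJ hi) ((h i hi).trans hz)

lemma Board.MarkedIso.fst_eq_one_iff {p : Board k G H} (hp : p.MarkedIso) {I : Finset (Fin k)}
    {z : G × H} (hz : z ∈ p.graph I) : z.1 = 1 ↔ z.2 = 1 := by
  obtain ⟨-, φ, hφ⟩ := hp
  have h : ∃ h : z.1 ∈ Subgroup.closure p.left, (φ ⟨z.1, h⟩ : H) = z.2 := by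
    induction hz using Subgroup.closure_induction with
    | mem z hz =>
      obtain ⟨i, -, hi⟩ := hz
      exact ⟨Subgroup.subset_closure ⟨i, z.2, hi⟩, hφ i z.2 _ hi⟩
    | one => exact ⟨one_mem _, by rw [show (⟨(1 : G × H).1, one_mem _⟩ :
        Subgroup.closure p.left) = 1 from rfl, map_one]; rfl⟩
    | mul a b _ _ ha hb =>
      obtain ⟨ha, ha'⟩ := ha
      obtain ⟨hb, hb'⟩ := hb
      refine ⟨mul_mem ha hb, ?_⟩
      rw [show (⟨(a * b).1, mul_mem ha hb⟩ : Subgroup.closure p.left) =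
        ⟨a.1, ha⟩ * ⟨b.1, hb⟩ from rfl, map_mul, Subgroup.coe_mul, ha', hb']
      rfl
    | inv a _ ha =>
      obtain ⟨ha, ha'⟩ := ha
      refine ⟨inv_mem ha, ?_⟩
      rw [show (⟨a⁻¹.1, inv_mem ha⟩ : Subgroup.closure p.left) = ⟨a.1, ha⟩⁻¹ from rfl,
        map_inv, Subgroup.coe_inv, ha']
      rfl
  obtain ⟨h, h'⟩ := h
  rw [← h', OneMemClass.coe_eq_one, map_eq_one_iff φ φ.injective, ← OneMemClass.coe_eq_one]

lemma SpoilerWins.of_not_markedIso {p : Board k G H} {i j : Fin k}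
    (h : ¬ (p.pickUp i j).MarkedIso) (r : ℕ) : SpoilerWins r p := by
  cases r with
  | zero => exact ⟨i, j, h⟩
  | succ r => exact ⟨i, j, Or.inl h⟩

/-- Spoiler wins within `r` rounds from every board on which some at most `n` pairs of pebbles
generate a subgroup of `G × H` that contains `Γ`. All that matters in a strategy is thus which
pairs of elements are forced to correspond, and how many pairs of pebbles have to stay for that. -/
def ForcedWin (k r n : ℕ) (Γ : Subgroup (G × H)) : Prop :=
  ∀ (p : Board k G H) (I : Finset (Fin k)), I.card ≤ n → Γ ≤ p.graph I → SpoilerWins r p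

/-- One pair of pebbles has to be free, as the winning condition is checked on picking up. -/
lemma ForcedWin.of_mem {r n : ℕ} {Γ : Subgroup (G × H)} (hn : n < k) {z : G × H} (hz : z ∈ Γ)
    (h : ¬ (z.1 = 1 ↔ z.2 = 1)) : ForcedWin k r n Γ := by
  intro p I hI hΓ
  obtain ⟨i, hi⟩ : ∃ i, i ∉ I := by
    by_contra! hall
    have h1 : I = Finset.univ := Finset.eq_univ_iff_forall.2 hall
    rw [h1, Finset.card_univ, Fintype.card_fin] at hI
    omega
  refine SpoilerWins.of_not_markedIso (i := i) (j := i) (fun hm => h ?_) r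
  refine hm.fst_eq_one_iff (I := I) (Board.graph_le_graph subset_rfl ?_ (hΓ hz))
  intro l hl
  have : l ≠ i := fun h => hi (h ▸ hl)
  exact p.pickUp_apply_of_ne this this

lemma ForcedWin.succ {r n : ℕ} {Γ : Subgroup (G × H)} (hn : n + 2 ≤ k)
    (h : ∀ f : G ≃ H, ∃ v w : G, ForcedWin k r (n + 2)
      (Γ ⊔ Subgroup.closure {(v, f v), (w, f w)})) : ForcedWin k (r + 1) n Γ := by
  intro p I hI hΓ
  have hc : 1 < Iᶜ.card := by
    rw [Finset.card_compl, Fintype.card_fin]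
    omega
  obtain ⟨i, hi, j, hj, hij⟩ := Finset.one_lt_card.1 hc
  rw [Finset.mem_compl] at hi hj
  refine ⟨i, j, Or.inr fun f => ?_⟩
  obtain ⟨v, w, hvw⟩ := h f
  refine ⟨v, w, hvw _ (insert i (insert j I)) ?_ (sup_le ?_ ?_)⟩
  · have h1 := Finset.card_insert_le i (insert j I)
    have h2 := Finset.card_insert_le j I
    omega
  · refine hΓ.trans (Board.graph_le_graph
      ((Finset.subset_insert _ _).trans (Finset.subset_insert _ _)) fun l hl => ?_)
    exact p.place_apply_of_ne f v w (fun h => hi (h ▸ hl)) (fun h => hj (h ▸ hl))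
  · rw [Subgroup.closure_le]
    rintro z (rfl | rfl)
    · exact Board.mem_graph (i := i) (by simp) (p.place_apply_left hij f v w)
    · exact Board.mem_graph (i := j) (by simp) (p.place_apply_right i j f v w)

lemma ForcedWin.succ_single {r n : ℕ} {Γ : Subgroup (G × H)} (hn : n + 1 ≤ k)
    (h : ∀ f : G ≃ H, ∃ v : G, ForcedWin k r (n + 1)
      (Γ ⊔ Subgroup.closure {(v, f v)})) : ForcedWin k (r + 1) n Γ := by
  intro p I hI hΓ
  have hc : 0 < Iᶜ.card := by
    rw [Finset.card_compl, Fintype.card_fin]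
    omega
  obtain ⟨i, hi⟩ := Finset.card_pos.1 hc
  rw [Finset.mem_compl] at hi
  refine ⟨i, i, Or.inr fun f => ?_⟩
  obtain ⟨v, hv⟩ := h f
  refine ⟨v, v, hv _ (insert i I) ?_ (sup_le ?_ ?_)⟩
  · have h1 := Finset.card_insert_le i I
    omega
  · refine hΓ.trans (Board.graph_le_graph (Finset.subset_insert _ _) fun l hl => ?_)
    exact p.place_apply_of_ne f v v (fun h => hi (h ▸ hl)) (fun h => hi (h ▸ hl))
  · rw [Subgroup.closure_le]
    rintro z rfl
    exact Board.mem_graph (i := i) (by simp) (p.place_apply_right i i f v v)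

lemma ForcedWin.of_isConj {n : ℕ} {Γ : Subgroup (G × H)} (hn : n + 2 ≤ k) {a b : G × H}
    (ha : a ∈ Γ) (hb : b ∈ Γ) (h : ¬ (IsConj a.1 b.1 ↔ IsConj a.2 b.2)) :
    ForcedWin k 1 n Γ := by
  refine ForcedWin.succ_single (by omega) fun f => ?_
  -- Spoiler pebbles a conjugating element of the side where there is one.
  obtain ⟨g, hg⟩ : ∃ g, ¬ (g * a.1 * g⁻¹ = b.1 ↔ f g * a.2 * (f g)⁻¹ = b.2) := by
    by_contra! hall
    refine h ?_
    rw [isConj_iff, isConj_iff]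
    exact ⟨fun ⟨g, hg⟩ => ⟨f g, (hall g).1 hg⟩,
      fun ⟨g, hg⟩ => ⟨f.symm g, (hall _).2 (by simpa using hg)⟩⟩
  refine ⟨g, ForcedWin.of_mem (z := (g, f g) * a * (g, f g)⁻¹ * b⁻¹) (by omega) ?_ ?_⟩
  · have hg : (g, f g) ∈ Γ ⊔ Subgroup.closure {(g, f g)} :=
      le_sup_right (a := Γ) (Subgroup.subset_closure rfl)
    have hle : Γ ≤ Γ ⊔ Subgroup.closure {(g, f g)} := le_sup_left
    exact mul_mem (mul_mem (mul_mem hg (hle ha)) (inv_mem hg)) (inv_mem (hle hb))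
  · simpa [mul_inv_eq_one] using hg

/-- Spoiler pebbles an edge of a path from `1` to `b` in the Cayley graph of the conjugacy class
of `a`, the image of which is not an edge, or the same with the two sides exchanged. -/
lemma ForcedWin.of_mem_normalClosure {n : ℕ} {Γ : Subgroup (G × H)} (hn : n + 4 ≤ k)
    {a b : G × H} (ha : a ∈ Γ) (hb : b ∈ Γ)
    (h : ¬ (b.1 ∈ Subgroup.normalClosure {a.1} ↔ b.2 ∈ Subgroup.normalClosure {a.2})) :
    ForcedWin k 2 n Γ := by
  refine ForcedWin.succ (by omega) fun f => ?_
  have hΓ : ∀ v w, Γ ≤ Γ ⊔ Subgroup.closure {(v, f v), (w, f w)} := fun _ _ => le_sup_left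
  have hl : ∀ v w, (v, f v) ∈ Γ ⊔ Subgroup.closure {(v, f v), (w, f w)} := fun v w =>
    le_sup_right (a := Γ) (Subgroup.subset_closure (Or.inl rfl))
  have hr : ∀ v w, (w, f w) ∈ Γ ⊔ Subgroup.closure {(v, f v), (w, f w)} := fun v w =>
    le_sup_right (a := Γ) (Subgroup.subset_closure (Or.inr rfl))
  by_cases h1 : f 1 = 1
  swap
  · exact ⟨1, 1, ForcedWin.of_mem (by omega) (hl 1 1) (by simpa using h1)⟩
  by_cases hfb : f b.1 = b.2
  swap
  · refine ⟨b.1, b.1, ForcedWin.of_mem (z := (b.1, f b.1) * b⁻¹) (by omega)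
      (mul_mem (hl _ _) (inv_mem (hΓ _ _ hb))) ?_⟩
    simpa [mul_inv_eq_one] using hfb
  obtain ⟨v, w, hvw⟩ :
      ∃ v w, ¬ (IsConj a.1 (v⁻¹ * w) ↔ IsConj a.2 ((f v)⁻¹ * f w)) := by
    by_contra! hall
    refine h ⟨fun hz => ?_, fun hz => ?_⟩
    · rw [← hfb]
      exact apply_mem_normalClosure f h1 (fun v w => (hall v w).1) hz
    · have h2 := apply_mem_normalClosure f.symm (f.symm_apply_eq.2 h1.symm)
        (fun v w hvw => (hall (f.symm v) (f.symm w)).2 (by simpa using hvw)) hz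
      rwa [← hfb, f.symm_apply_apply] at h2
  exact ⟨v, w, ForcedWin.of_isConj (b := (v, f v)⁻¹ * (w, f w)) (by omega) (hΓ v w ha)
    (mul_mem (inv_mem (hl v w)) (hr v w)) hvw⟩

end Strategy

section MinimalNormal

variable {G H : Type*} [Group G] [Group H]

/-- The normal closure of `c` contains no smaller nontrivial normal subgroup: `c` is `1` or lies in
a minimal normal subgroup. -/
def GeneratesMinimalNormal (c : G) : Prop :=
  ∀ d ∈ Subgroup.normalClosure {c}, d ≠ 1 → c ∈ Subgroup.normalClosure {d}

lemma IsMinimalNormal.generatesMinimalNormal {N : Subgroup G} (hN : IsMinimalNormal N) {c : G}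
    (hc : c ∈ N) : GeneratesMinimalNormal c := by
  have := hN.1
  intro d hd hd1
  have hdN : d ∈ N := Subgroup.normalClosure_le_normal (by simpa using hc) hd
  rcases hN.2.2 (Subgroup.normalClosure {d}) inferInstance
    (Subgroup.normalClosure_le_normal (by simpa using hdN)) with h | h
  · have : d ∈ Subgroup.normalClosure {d} := Subgroup.subset_normalClosure rfl
    rw [h] at this
    exact absurd this hd1
  · rwa [h]

lemma GeneratesMinimalNormal.mem_socle {c : G} (hc : GeneratesMinimalNormal c) : c ∈ socle G := by
  by_cases h1 : c = 1
  · rw [h1]; exact one_mem _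
  have hcc : c ∈ Subgroup.normalClosure {c} := Subgroup.subset_normalClosure rfl
  refine (le_sSup ?_ : Subgroup.normalClosure {c} ≤ socle G) hcc
  refine ⟨inferInstance, fun h => h1 (by rwa [h] at hcc), fun M hM hMc => ?_⟩
  by_cases hb : M = ⊥
  · exact Or.inl hb
  obtain ⟨⟨d, hd⟩, hd1⟩ := Subgroup.ne_bot_iff_exists_ne_one.1 hb
  refine Or.inr (le_antisymm hMc (Subgroup.normalClosure_le_normal ?_))
  have := Subgroup.normalClosure_le_normal (N := M) (s := {d}) (by simpa using hd)
    (hc d (hMc hd) fun h => hd1 (Subtype.ext h))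
  simpa using this

lemma socle_eq_closure :
    socle G = Subgroup.closure {c | ∃ N : Subgroup G, IsMinimalNormal N ∧ c ∈ N} := by
  apply le_antisymm
  · exact sSup_le fun N hN c hc => Subgroup.subset_closure ⟨N, hN, hc⟩
  · rw [Subgroup.closure_le]
    rintro c ⟨N, hN, hc⟩
    exact (le_sSup hN : N ≤ socle G) hc

/-- Spoiler pebbles an element `d` of the normal closure on the `H` side that witnesses its failure
to be minimal; one of two normal closures is then not respected. -/
lemma ForcedWin.of_generatesMinimalNormal {k n : ℕ} {Γ : Subgroup (G × H)} (hn : n + 5 ≤ k)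
    {c : G × H} (hc : c ∈ Γ) (h1 : GeneratesMinimalNormal c.1)
    (h2 : ¬ GeneratesMinimalNormal c.2) : ForcedWin k 3 n Γ := by
  unfold GeneratesMinimalNormal at h2
  push Not at h2
  obtain ⟨d, hd, hd1, hcd⟩ := h2
  refine ForcedWin.succ_single (by omega) fun f => ⟨f.symm d, ?_⟩
  have hcΓ := (le_sup_left : Γ ≤ Γ ⊔ Subgroup.closure {(f.symm d, f (f.symm d))}) hc
  have hdΓ : (f.symm d, d) ∈ Γ ⊔ Subgroup.closure {(f.symm d, f (f.symm d))} :=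
    le_sup_right (a := Γ) (Subgroup.subset_closure (by simp))
  by_cases he : f.symm d = 1
  · exact ForcedWin.of_mem (by omega) hdΓ (by simp [he, hd1])
  by_cases hdc : f.symm d ∈ Subgroup.normalClosure {c.1}
  · exact ForcedWin.of_mem_normalClosure (by omega) hdΓ hcΓ
      (fun h => hcd (h.1 (h1 _ hdc he)))
  · exact ForcedWin.of_mem_normalClosure (by omega) hcΓ hdΓ (fun h => hdc (h.2 hd))

end MinimalNormal

/-! ### Multiplicativity on the socle -/

section Multiplicativity

variable {G H : Type*} [Group G] [Group H]

/-- If `K` is normalized by the subgroup `D` and `f` maps `K` onto a subgroup `L`, then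
compatibility of `f` with translations by `D` makes `f` multiplicative modulo `L` on `D K`.
Normality of `L` is not needed: `L` is normalized by the image of `D`. -/
lemma apply_mul_modulo {f : G → H} {D K : Subgroup G} {L : Subgroup H}
    (hKL : ∀ k ∈ K, f k ∈ L)
    (hl : ∀ d ∈ D, ∀ v, f (d * v) = f d * f v) (hr : ∀ d ∈ D, ∀ v, f (v * d) = f v * f d)
    (hD : ∀ d ∈ D, ∀ k ∈ K, d⁻¹ * k * d ∈ K) {s t d e : G} (hd : d ∈ D) (he : e ∈ D)
    (hs : d⁻¹ * s ∈ K) (ht : e⁻¹ * t ∈ K) : (f s * f t)⁻¹ * f (s * t) ∈ L := by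
  obtain ⟨a, rfl⟩ : ∃ a, s = d * a := ⟨d⁻¹ * s, by simp⟩
  obtain ⟨b, rfl⟩ : ∃ b, t = e * b := ⟨e⁻¹ * t, by simp⟩
  rw [inv_mul_cancel_left] at hs ht
  have hf1 : f 1 = 1 := by simpa using hl 1 D.one_mem 1
  have hinv : f e⁻¹ = (f e)⁻¹ := by
    have := hl e he e⁻¹
    rw [mul_inv_cancel, hf1] at this
    exact (inv_eq_of_mul_eq_one_right this.symm).symm
  have hc : f (e⁻¹ * a * e) = (f e)⁻¹ * f a * f e := by
    rw [hr e he, hl _ (inv_mem he), hinv]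
  have hst : f (d * a * (e * b)) = f d * f e * f (e⁻¹ * a * e * b) := by
    rw [← hl d hd, ← hl _ (mul_mem hd he)]
    congr 1
    group
  have h1 : f (e⁻¹ * a * e * b) ∈ L := hKL _ (mul_mem (hD e he a hs) ht)
  have h2 : (f e)⁻¹ * f a * f e ∈ L := hc ▸ hKL _ (hD e he a hs)
  have h3 : (f (d * a) * f (e * b))⁻¹ * f (d * a * (e * b)) =
      (f b)⁻¹ * ((f e)⁻¹ * f a * f e)⁻¹ * f (e⁻¹ * a * e * b) := by
    rw [hst, hl d hd, hl e he]
    group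
  rw [h3]
  exact mul_mem (mul_mem (inv_mem (hKL b ht)) (inv_mem h2)) h1

/-- A map that is compatible with the translations by generators of a subgroup is compatible with
the translations by all of its elements. -/
lemma apply_mul_of_mem_closure {f : G → H} {X : Set G}
    (hl : ∀ x ∈ X, ∀ v, f (x * v) = f x * f v) (hr : ∀ x ∈ X, ∀ v, f (v * x) = f v * f x)
    (h1 : f 1 = 1) {d : G} (hd : d ∈ Subgroup.closure X) :
    (∀ v, f (d * v) = f d * f v) ∧ ∀ v, f (v * d) = f v * f d := by
  induction hd using Subgroup.closure_induction with
  | mem x hx => exact ⟨hl x hx, hr x hx⟩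
  | one => simp [h1]
  | mul a b _ _ ha hb =>
    refine ⟨fun v => ?_, fun v => ?_⟩
    · rw [mul_assoc, ha.1, hb.1, ha.1, mul_assoc]
    · rw [← mul_assoc, hb.2, ha.2, hb.2 a, mul_assoc]
  | inv a _ ha =>
    have hi : f a⁻¹ = (f a)⁻¹ := by
      have := ha.1 a⁻¹
      rw [mul_inv_cancel, h1] at this
      exact (inv_eq_of_mul_eq_one_right this.symm).symm
    refine ⟨fun v => ?_, fun v => ?_⟩
    · rw [hi, eq_inv_mul_iff_mul_eq, ← ha.1, mul_inv_cancel_left]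
    · rw [hi, eq_mul_inv_iff_mul_eq, ← ha.2, inv_mul_cancel_right]

end Multiplicativity

section Components

variable {G : Type*} [Group G]

/-- The elements of the socle that commute with `S`. For a factor `S` of the socle this is the
product of the other factors, so that the socle modulo `complementOf S` is isomorphic to `S`. -/
def complementOf (S : Subgroup G) : Subgroup G :=
  socle G ⊓ Subgroup.centralizer (S : Set G)

lemma mem_complementOf {S : Subgroup G} {a : G} :
    a ∈ complementOf S ↔ a ∈ socle G ∧ ∀ s ∈ S, s * a = a * s :=
  and_congr_right fun _ => Subgroup.mem_centralizer_iff

lemma conj_mem_complementOf {S : Subgroup G} (hS : S ∈ socleFactors G) {a k : G}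
    (ha : a ∈ socle G) (hk : k ∈ complementOf S) : a⁻¹ * k * a ∈ complementOf S := by
  rw [mem_complementOf] at hk ⊢
  refine ⟨mul_mem (mul_mem (inv_mem ha) hk.1) ha, fun s hs => ?_⟩
  have h := hk.2 _ (conj_mem_of_le_normalizer (socle_le_normalizer_of_mem_socleFactors hS) ha hs)
  calc s * (a⁻¹ * k * a) = a⁻¹ * (a * s * a⁻¹ * k) * a := by group
    _ = a⁻¹ * k * a * s := by rw [h]; group

/-- The component in one factor of a product with one element from each factor. -/
lemma inv_mul_prod_mem_complementOf {m : ℕ} {S : Fin m → Subgroup G}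
    (hSinj : Function.Injective S) (hS : ∀ i, S i ∈ socleFactors G) {x : Fin m → G}
    (hx : ∀ i, x i ∈ S i) (i : Fin m) :
    (x i)⁻¹ * (List.ofFn x).prod ∈ complementOf (S i) := by
  have hA : ∀ j, x j ∈ socle G := fun j => le_socle_of_mem_socleFactors (hS j) (hx j)
  have hne : ∀ j, j ≠ i → x j ∈ complementOf (S i) := fun j hj =>
    mem_complementOf.2 ⟨hA j, fun s hs =>
      commute_of_mem_socleFactors (hS i) (hS j) (fun h => hj (hSinj h).symm) hs (hx j)⟩
  have key : ∀ l : List (Fin m), l.Nodup →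
      (i ∉ l → (l.map x).prod ∈ complementOf (S i)) ∧
      (i ∈ l → (x i)⁻¹ * (l.map x).prod ∈ complementOf (S i)) := by
    intro l
    induction l with
    | nil => simp
    | cons j l ih =>
      intro hnd
      rw [List.nodup_cons] at hnd
      obtain ⟨ih1, ih2⟩ := ih hnd.2
      rw [List.map_cons, List.prod_cons]
      refine ⟨fun hi => ?_, fun hi => ?_⟩
      · rw [List.mem_cons, not_or] at hi
        exact mul_mem (hne j (Ne.symm hi.1)) (ih1 hi.2)
      · by_cases hj : j = i
        · subst hj
          rw [inv_mul_cancel_left]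
          exact ih1 hnd.1
        · have hil : i ∈ l := (List.mem_cons.1 hi).resolve_left (Ne.symm hj)
          have hcomm := (mem_complementOf.1 (hne j hj)).2 _ (inv_mem (hx i))
          rw [← mul_assoc, hcomm, mul_assoc]
          exact mul_mem (hne j hj) (ih2 hil)
  rw [List.ofFn_eq_map]
  exact (key _ (List.nodup_finRange m)).2 (List.mem_finRange i)

/-- A subgroup of the socle that projects onto a set of generators of the factor `S` projects
onto all of `S`. -/
lemma exists_inv_mul_mem_complementOf {S D : Subgroup G} (hS : S ∈ socleFactors G)
    (hD : D ≤ socle G) {X : Set G} (hX : S = Subgroup.closure X)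
    (hXD : ∀ x ∈ X, ∃ d ∈ D, x⁻¹ * d ∈ complementOf S) {s : G} (hs : s ∈ socle G) :
    ∃ d ∈ D, d⁻¹ * s ∈ complementOf S := by
  -- the product of `D` and `complementOf S`
  let B : Subgroup G :=
    { carrier := {s | ∃ d ∈ D, d⁻¹ * s ∈ complementOf S}
      one_mem' := ⟨1, one_mem _, by simp [one_mem]⟩
      mul_mem' := by
        rintro a b ⟨d, hd, ha⟩ ⟨e, he, hb⟩
        refine ⟨d * e, mul_mem hd he, ?_⟩
        have := mul_mem (conj_mem_complementOf hS (hD he) ha) hb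
        convert this using 1
        group
      inv_mem' := by
        rintro a ⟨d, hd, ha⟩
        refine ⟨d⁻¹, inv_mem hd, ?_⟩
        have := conj_mem_complementOf hS (inv_mem (hD hd)) (inv_mem ha)
        convert this using 1
        group }
  have hSB : S ≤ B := by
    rw [hX, Subgroup.closure_le]
    intro x hx
    obtain ⟨d, hd, h⟩ := hXD x hx
    refine ⟨d, hd, ?_⟩
    have := inv_mem h
    rwa [mul_inv_rev, inv_inv] at this
  obtain ⟨-, C, hC, -, hSC⟩ := id hS
  have hCB : C ≤ B := fun c hc => ⟨1, one_mem _, by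
    rw [inv_one, one_mul, mem_complementOf, ← hC]
    exact ⟨(le_sup_right : C ≤ S ⊔ C) hc, fun s hs => hSC s hs c hc⟩⟩
  rw [← hC] at hs
  exact sup_le hSB hCB hs

/-- An element of the socle all of whose components are trivial is trivial. -/
lemma IsSemisimple.eq_one_of_forall_mem_complementOf [Finite G] (hG : IsSemisimple G) {m : ℕ}
    {S : Fin m → Subgroup G} (hS : Set.range S = socleFactors G) {a : G} (ha : a ∈ socle G)
    (h : ∀ i, a ∈ complementOf (S i)) : a = 1 := by
  refine hG.eq_one_of_commute_socle ha fun b hb =>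
    mem_centralizer_sSup (fun R hR r hr => ?_) (socle_le_sSup_socleFactors hG hb)
  rw [← hS] at hR
  obtain ⟨i, rfl⟩ := hR
  exact ((mem_complementOf.1 (h i)).2 r hr).symm

/-- A bijection that maps the socle onto the socle, respects commutation there, and is compatible
with the translations by a subgroup `D` that projects onto every factor, is multiplicative on the
socle. -/
lemma map_mul_of_commute_iff {H : Type*} [Group H] [Finite G] (hG : IsSemisimple G) {m : ℕ}
    {S : Fin m → Subgroup G} (hS : Set.range S = socleFactors G) (f : G ≃ H)
    (hf : ∀ a, a ∈ socle G ↔ f a ∈ socle H)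
    (hcomm : ∀ a b, a * b = b * a ↔ f a * f b = f b * f a)
    {D : Subgroup G} (hD : D ≤ socle G)
    (hl : ∀ d ∈ D, ∀ v, f (d * v) = f d * f v) (hr : ∀ d ∈ D, ∀ v, f (v * d) = f v * f d)
    (hproj : ∀ i, ∀ s ∈ socle G, ∃ d ∈ D, d⁻¹ * s ∈ complementOf (S i))
    {s t : G} (hs : s ∈ socle G) (ht : t ∈ socle G) : f (s * t) = f s * f t := by
  have hSf : ∀ i, S i ∈ socleFactors G := fun i => hS ▸ Set.mem_range_self i
  -- the image of `complementOf (S i)`, which is a subgroup by the second description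
  let L : Fin m → Subgroup H := fun i => socle H ⊓ Subgroup.centralizer (f '' (S i : Set G))
  have hL : ∀ i a, a ∈ complementOf (S i) ↔ f a ∈ L i := by
    intro i a
    rw [mem_complementOf, Subgroup.mem_inf, ← hf, Subgroup.mem_centralizer_iff,
      Set.forall_mem_image]
    exact and_congr_right fun _ => forall₂_congr fun b _ => hcomm b a
  have hf1 : f 1 = 1 := by simpa using hl 1 D.one_mem 1
  have hz : (f s * f t)⁻¹ * f (s * t) ∈ socle H :=
    mul_mem (inv_mem (mul_mem ((hf s).1 hs) ((hf t).1 ht))) ((hf _).1 (mul_mem hs ht))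
  have key : f.symm ((f s * f t)⁻¹ * f (s * t)) = 1 := by
    refine hG.eq_one_of_forall_mem_complementOf hS ((hf _).2 (by simpa using hz)) fun i => ?_
    obtain ⟨d, hd, hds⟩ := hproj i s hs
    obtain ⟨e, he, het⟩ := hproj i t ht
    rw [hL, f.apply_symm_apply]
    exact apply_mul_modulo (fun k hk => (hL i k).1 hk) hl hr
      (fun d hd k hk => conj_mem_complementOf (hSf i) (hD hd) hk) hd he hds het
  rw [f.symm_apply_eq, hf1] at key
  exact (inv_mul_eq_one.1 key).symm

end Components

section Socles

variable {G H : Type*} [Group G] [Group H]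

/-- A bijection that respects the property of generating a minimal normal subgroup along the edges
of the Cayley graph of the union of the minimal normal subgroups maps the socle onto the socle. -/
lemma mem_socle_iff_apply_mem_socle [Finite H] (hsoc : Nonempty (socle G ≃* socle H)) (f : G ≃ H)
    (h1 : f 1 = 1)
    (h : ∀ v w, GeneratesMinimalNormal (v⁻¹ * w) → GeneratesMinimalNormal ((f v)⁻¹ * f w)) (a : G) :
    a ∈ socle G ↔ f a ∈ socle H := by
  have hsub : f '' (socle G : Set G) ⊆ (socle H : Set H) := by
    rintro _ ⟨a, ha, rfl⟩
    rw [SetLike.mem_coe, socle_eq_closure] at ha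
    refine apply_mem_of_mem_closure f h1 (fun v w => ?_) ha
    rintro ⟨N, hN, hc⟩
    exact (h v w (hN.generatesMinimalNormal hc)).mem_socle
  have heq : f '' (socle G : Set G) = (socle H : Set H) := by
    refine Set.eq_of_subset_of_ncard_le hsub ?_ (Set.toFinite _)
    rw [Set.ncard_image_of_injective _ f.injective]
    obtain ⟨e⟩ := hsoc
    exact (Nat.card_congr e.toEquiv).ge
  refine ⟨fun ha => hsub ⟨a, ha, rfl⟩, fun ha => ?_⟩
  rw [← SetLike.mem_coe, ← heq] at ha
  obtain ⟨b, hb, hba⟩ := ha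
  exact f.injective hba ▸ hb

lemma restrictsToSocleIso_of_map_mul (f : G ≃ H) (hf : ∀ a, a ∈ socle G ↔ f a ∈ socle H)
    (hmul : ∀ s ∈ socle G, ∀ t ∈ socle G, f (s * t) = f s * f t) : RestrictsToSocleIso f :=
  ⟨{ f.subtypeEquiv hf with
      map_mul' := fun s t => Subtype.ext (hmul s s.2 t t.2) }, fun _ => rfl⟩

end Socles

end PebbleGame

/-! ### The bijection in the game with seven pairs of pebbles -/

theorem mainTheorem6 {G H : Type*} [Group G] [Group H] [Finite G] [Finite H]
    (hG : PebbleGame.IsSemisimple G) (hH : PebbleGame.IsSemisimple H)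
    (hsoc : Nonempty (PebbleGame.socle G ≃* PebbleGame.socle H))
    (m : ℕ) (S : Fin m → Subgroup G) (hSinj : Function.Injective S)
    (hS : Set.range S = PebbleGame.socleFactors G)
    (x y : Fin m → G) (hxy : ∀ i, S i = Subgroup.closure {x i, y i})
    (f₀ : G ≃ H)
    (hf₁ : ∀ i, ∃ T ∈ PebbleGame.socleFactors H,
      f₀ '' (S i : Set G) = (T : Set H) ∧ Nonempty (S i ≃* T))
    (hf₂ : ∀ s ∈ PebbleGame.socle G, ∃ w : ℕ,
      PebbleGame.HasWeight s w ∧ PebbleGame.HasWeight (f₀ s) w)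
    (hf₃ : ∀ i, f₀ '' (S i : Set G) = (Subgroup.closure {f₀ (x i), f₀ (y i)} : Set H))
    (p : PebbleGame.Board 7 G H) (a b : Fin 7) (hab : a ≠ b)
    (hpa : p a = some ((List.ofFn x).prod, f₀ (List.ofFn x).prod))
    (hpb : p b = some ((List.ofFn y).prod, f₀ (List.ofFn y).prod))
    (i j : Fin 7) (hij : i ≠ j) (hia : i ≠ a) (hib : i ≠ b) (hja : j ≠ a) (hjb : j ≠ b)
    (f' : G ≃ H) :
    PebbleGame.RestrictsToSocleIso f' ∨ PebbleGame.SpoilerWinsAgainst 3 p i j f' := by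
  open PebbleGame in
  refine or_iff_not_imp_right.2 fun hlose => ?_
  have hlose' : ∀ v w, ¬ SpoilerWins 3 (p.place i j f' v w) := fun v w h => hlose ⟨v, w, h⟩
  set X := (List.ofFn x).prod
  set Y := (List.ofFn y).prod
  -- The four pairs on `X`, `Y`, `v`, `w` leave three pairs free, enough to check them at once.
  have hiso : ∀ v w, ∀ z ∈ Subgroup.closure
      ({(X, f₀ X), (Y, f₀ Y), (v, f' v), (w, f' w)} : Set (G × H)), z.1 = 1 ↔ z.2 = 1 := by
    intro v w z hz
    by_contra hne
    refine hlose' v w (ForcedWin.of_mem (n := 4) (by omega) hz hne _ {a, b, i, j} ?_ ?_)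
    · exact Finset.card_le_four
    · rw [Subgroup.closure_le]
      rintro z (rfl | rfl | rfl | rfl)
      · exact Board.mem_graph (i := a) (by simp)
          ((p.place_apply_of_ne f' v w hia.symm hja.symm).trans hpa)
      · exact Board.mem_graph (i := b) (by simp)
          ((p.place_apply_of_ne f' v w hib.symm hjb.symm).trans hpb)
      · exact Board.mem_graph (i := i) (by simp) (p.place_apply_left hij f' v w)
      · exact Board.mem_graph (i := j) (by simp) (p.place_apply_right i j f' v w)
  have hedge : ∀ v w, GeneratesMinimalNormal (v⁻¹ * w) →
      GeneratesMinimalNormal ((f' v)⁻¹ * f' w) := by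
    intro v w h
    by_contra hne
    refine hlose' v w (ForcedWin.of_generatesMinimalNormal (n := 2)
      (Γ := Subgroup.closure {(v, f' v), (w, f' w)}) (c := (v, f' v)⁻¹ * (w, f' w)) (by omega)
      ?_ h hne _ {i, j} Finset.card_le_two ?_)
    · exact mul_mem (inv_mem (Subgroup.subset_closure (Or.inl rfl)))
        (Subgroup.subset_closure (Or.inr rfl))
    · rw [Subgroup.closure_le]
      rintro z (rfl | rfl)
      · exact Board.mem_graph (i := i) (by simp) (p.place_apply_left hij f' v w)
      · exact Board.mem_graph (i := j) (by simp) (p.place_apply_right i j f' v w)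
  have hmem : ∀ v w, ∀ z ∈ ({(X, f₀ X), (Y, f₀ Y), (v, f' v), (w, f' w)} : Set (G × H)),
      z ∈ Subgroup.closure ({(X, f₀ X), (Y, f₀ Y), (v, f' v), (w, f' w)} : Set (G × H)) :=
    fun v w z hz => Subgroup.subset_closure hz
  have h1 : f' 1 = 1 := (hiso 1 1 _ (hmem 1 1 (1, f' 1) (by simp))).1 rfl
  have hcomm : ∀ v w, v * w = w * v ↔ f' v * f' w = f' w * f' v := by
    intro v w
    have hv := hmem v w (v, f' v) (by simp)
    have hw := hmem v w (w, f' w) (by simp)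
    have := hiso v w _ (mul_mem (mul_mem hv hw) (inv_mem (mul_mem hw hv)))
    simpa [mul_inv_eq_one, ← mul_inv_rev] using this
  have hfX : f' X = f₀ X := by
    have := (hiso X X _ (mul_mem (hmem X X (X, f' X) (by simp))
      (inv_mem (hmem X X (X, f₀ X) (by simp))))).1 (by simp)
    exact mul_inv_eq_one.1 this
  have hfY : f' Y = f₀ Y := by
    have := (hiso Y Y _ (mul_mem (hmem Y Y (Y, f' Y) (by simp))
      (inv_mem (hmem Y Y (Y, f₀ Y) (by simp))))).1 (by simp)
    exact mul_inv_eq_one.1 this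
  -- `f'` extends the marked map on `X`, `Y`, so it commutes with the translations by `X` and `Y`:
  -- Spoiler could have pebbled `v` and `X v`.
  have hXY : ∀ u ∈ ({X, Y} : Set G), ∀ v w,
      (u, f' u) ∈ Subgroup.closure
        ({(X, f₀ X), (Y, f₀ Y), (v, f' v), (w, f' w)} : Set (G × H)) := by
    rintro u (rfl | rfl) v w
    · exact hmem v w (X, f' X) (by simp [hfX])
    · exact hmem v w (Y, f' Y) (by simp [hfY])
  have hl : ∀ u ∈ ({X, Y} : Set G), ∀ v, f' (u * v) = f' u * f' v := by
    intro u hu v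
    have := (hiso v (u * v) _ (mul_mem (hmem v (u * v) (u * v, f' (u * v)) (by simp)) (inv_mem
      (mul_mem (hXY u hu v (u * v)) (hmem v (u * v) (v, f' v) (by simp)))))).1 (by simp)
    exact mul_inv_eq_one.1 this
  have hr : ∀ u ∈ ({X, Y} : Set G), ∀ v, f' (v * u) = f' v * f' u := by
    intro u hu v
    have := (hiso v (v * u) _ (mul_mem (hmem v (v * u) (v * u, f' (v * u)) (by simp)) (inv_mem
      (mul_mem (hmem v (v * u) (v, f' v) (by simp)) (hXY u hu v (v * u)))))).1 (by simp)
    exact mul_inv_eq_one.1 this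
  have hsocle := mem_socle_iff_apply_mem_socle hsoc f' h1 hedge
  have hSf : ∀ l, S l ∈ socleFactors G := fun l => hS ▸ Set.mem_range_self l
  have hx : ∀ l, x l ∈ S l := fun l => by
    rw [hxy l]; exact Subgroup.subset_closure (by simp)
  have hy : ∀ l, y l ∈ S l := fun l => by
    rw [hxy l]; exact Subgroup.subset_closure (by simp)
  have hprod : ∀ c : Fin m → G, (∀ l, c l ∈ S l) → (List.ofFn c).prod ∈ socle G := by
    intro c hc
    refine Subgroup.list_prod_mem _ fun g hg => ?_
    obtain ⟨l, rfl⟩ := (List.mem_ofFn' c g).1 hg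
    exact le_socle_of_mem_socleFactors (hSf l) (hc l)
  have hD : Subgroup.closure {X, Y} ≤ socle G := by
    rw [Subgroup.closure_le]
    rintro u (rfl | rfl)
    · exact hprod x hx
    · exact hprod y hy
  refine restrictsToSocleIso_of_map_mul f' hsocle fun s hs t ht =>
    map_mul_of_commute_iff hG hS f' hsocle hcomm hD
      (fun d hd => (apply_mul_of_mem_closure hl hr h1 hd).1)
      (fun d hd => (apply_mul_of_mem_closure hl hr h1 hd).2) (fun l s hs => ?_) hs ht
  refine exists_inv_mul_mem_complementOf (hSf l) hD (hxy l) ?_ hs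
  rintro u (rfl | rfl)
  · exact ⟨X, Subgroup.subset_closure (by simp), inv_mul_prod_mem_complementOf hSinj hSf hx l⟩
  · exact ⟨Y, Subgroup.subset_closure (by simp), inv_mul_prod_mem_complementOf hSinj hSf hy l⟩
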